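/- Proposition 3.8 (SU(2)-bundles on CW complexes of dimension $\le 3$). Let $X$ be a (Hausdorff) CW complex of dimension at most $3$, that is, one without cells of dimension $n>3$. Let $\pi : P\to X$ be a topological principal $\mathrm{SU}(2)$-bundle, that is, a continuous map together with a continuous right action of $\mathrm{SU}(2)$ on $P$ preserving the fibres of $\pi$, such that every point of $X$ has an open neighbourhood $U$ with an $\mathrm{SU}(2)$-equivariant homeomorphism $\pi^{-1}(U)\cong U\times \mathrm{SU}(2)$ over $U$, where $\mathrm{SU}(2)$ acts on $U\times\mathrm{SU}(2)$ by right multiplication on the second factor. Then $P$ is trivial: there is an $\mathrm{SU}(2)$-equivariant homeomorphism $P\cong X\times \mathrm{SU}(2)$ over $X$. -/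

import Mathlib

/-- The special unitary group `SU(2)`: unitary `2 × 2` complex matrices of determinant `1`, with
matrix multiplication and the subspace topology. -/
abbrev SU2 : Type := Matrix.specialUnitaryGroup (Fin 2) ℂ

/-- `π : P → X` is a topological principal `G`-bundle for the given right action of `G` on `P`
(a right action of `G` is an action of the opposite group, so that `MulOpposite.op g • p` is `p · g`):
the action is continuous, it preserves the fibres of `π`, and every point of `X` lies in the (open)
base set of a local trivialization of `π` with fibre `G` that is equivariant for the right
multiplication of `G` on itself. -/
structure IsPrincipalBundle (G : Type*) [Group G] [TopologicalSpace G]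
    {P X : Type*} [TopologicalSpace P] [TopologicalSpace X] [MulAction (MulOpposite G) P]
    (π : P → X) : Prop where
  continuous_proj : Continuous π
  continuous_act : Continuous fun q : P × G => MulOpposite.op q.2 • q.1
  proj_act : ∀ (p : P) (g : G), π (MulOpposite.op g • p) = π p
  locally_trivial : ∀ x : X, ∃ e : Bundle.Trivialization G π, x ∈ e.baseSet ∧
    ∀ p : P, π p ∈ e.baseSet → ∀ g : G, (e (MulOpposite.op g • p)).2 = (e p).2 * g

/-- `π : P → X` is trivial as a principal `G`-bundle: it is isomorphic, by a `G`-equivariant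
homeomorphism over `X`, to the product bundle `X × G → X` with `(x, h) · g = (x, h * g)`. -/
def IsTrivialPrincipalBundle (G : Type*) [Group G] [TopologicalSpace G]
    {P X : Type*} [TopologicalSpace P] [TopologicalSpace X] [MulAction (MulOpposite G) P]
    (π : P → X) : Prop :=
  ∃ φ : P ≃ₜ X × G, (∀ p : P, (φ p).1 = π p) ∧
    ∀ (p : P) (g : G), φ (MulOpposite.op g • p) = ((φ p).1, (φ p).2 * g)

/-!
A principal bundle with a global section is trivial, so it suffices to build a section of `π`, and
this is done by induction on the dimension of the cells. Over a cell with characteristic map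
`χ : [-1, 1]ⁿ → X` two facts are used.

* `χ` lifts to `P` (`IsPrincipalBundle.liftsOn_Icc`): it does so over small boxes because `π` is
  locally trivial, and lifts over two boxes sharing a face can be glued, since the group-valued
  function comparing them on the face extends over either box by projecting onto the face.
* Relative to such a lift, the section already built on the boundary of the cell is a map
  `∂[-1, 1]ⁿ → SU(2)`. It extends to the cube as long as `n ≤ 3`
  (`extendsFromSphere_specialUnitaryGroup`), because `SU(2)` is the unit sphere of a real vector
  space of dimension `4`: a generic smooth map from a space of dimension `n < 4` misses `0`
  (`exists_continuous_extension_ne_zero`).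

The sections over the closed cells fit together because a complex carries the weak topology.
-/

open Set Topology Metric

/-! ### Principal bundles, sections and the translation function -/

section Translation

variable {G : Type*} [Group G] [TopologicalSpace G] {P X : Type*} [TopologicalSpace P]
  [TopologicalSpace X] [MulAction (MulOpposite G) P] {π : P → X}

theorem IsPrincipalBundle.op_smul_eq_iff (hπ : IsPrincipalBundle G π)
    {e : Bundle.Trivialization G π}
    (he : ∀ p : P, π p ∈ e.baseSet → ∀ g : G, (e (MulOpposite.op g • p)).2 = (e p).2 * g)
    {p q : P} (hp : π p ∈ e.baseSet) (hpq : π p = π q) (g : G) :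
    MulOpposite.op g • p = q ↔ g = (e p).2⁻¹ * (e q).2 := by
  rw [eq_inv_mul_iff_mul_eq, ← he p hp g]
  refine ⟨fun h => by rw [h], fun h => ?_⟩
  have hgp : MulOpposite.op g • p ∈ e.source := by rwa [e.mem_source, hπ.proj_act]
  have hq : q ∈ e.source := by rwa [e.mem_source, ← hpq]
  refine e.injOn hgp hq (Prod.ext ?_ h)
  change (e _).1 = (e _).1
  rw [e.coe_fst hgp, e.coe_fst hq, hπ.proj_act, hpq]

theorem IsPrincipalBundle.op_smul_injective (hπ : IsPrincipalBundle G π) (p : P) {a b : G}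
    (h : MulOpposite.op a • p = MulOpposite.op b • p) : a = b := by
  obtain ⟨e, hx, he⟩ := hπ.locally_trivial (π p)
  have hpq : π p = π (MulOpposite.op b • p) := (hπ.proj_act p b).symm
  rw [(hπ.op_smul_eq_iff he hx hpq a).1 h, ← (hπ.op_smul_eq_iff he hx hpq b).1 rfl]

/-- Two continuous families of points of `P` lying over the same points of the base differ by a
continuous family of group elements. -/
theorem IsPrincipalBundle.exists_continuousOn_translation [IsTopologicalGroup G]
    (hπ : IsPrincipalBundle G π) {Y : Type*} [TopologicalSpace Y] {S : Set Y} {f h : Y → P}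
    (hf : ContinuousOn f S) (hh : ContinuousOn h S) (hfh : ∀ y ∈ S, π (f y) = π (h y)) :
    ∃ g : Y → G, ContinuousOn g S ∧ ∀ y ∈ S, MulOpposite.op (g y) • f y = h y := by
  classical
  have hex : ∀ y, ∃ g : G, y ∈ S → MulOpposite.op g • f y = h y := fun y => by
    by_cases hy : y ∈ S
    · obtain ⟨e, hx, he⟩ := hπ.locally_trivial (π (f y))
      exact ⟨_, fun _ => (hπ.op_smul_eq_iff he hx (hfh y hy) _).2 rfl⟩
    · exact ⟨1, fun h => absurd h hy⟩
  choose g hg using hex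
  refine ⟨g, fun y hy => ?_, hg⟩
  obtain ⟨e, hx, he⟩ := hπ.locally_trivial (π (f y))
  have hfs : f y ∈ e.source := e.mem_source.2 hx
  have hhs : h y ∈ e.source := e.mem_source.2 (hfh y hy ▸ hx)
  have hc : ContinuousWithinAt (fun z => (e (f z)).2⁻¹ * (e (h z)).2) S y := by
    have h1 : ContinuousWithinAt (fun z => e (f z)) S y :=
      (e.toOpenPartialHomeomorph.continuousAt hfs).comp_continuousWithinAt (hf y hy)
    have h2 : ContinuousWithinAt (fun z => e (h z)) S y :=
      (e.toOpenPartialHomeomorph.continuousAt hhs).comp_continuousWithinAt (hh y hy)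
    exact h1.snd.inv.mul h2.snd
  refine hc.congr_of_eventuallyEq ?_ ((hπ.op_smul_eq_iff he hx (hfh y hy) _).1 (hg y hy))
  have hnear : ∀ᶠ z in 𝓝[S] y, f z ∈ e.source :=
    (hf y hy).eventually (e.open_source.mem_nhds hfs)
  filter_upwards [hnear, self_mem_nhdsWithin] with z hz hzS
  exact (hπ.op_smul_eq_iff he (e.mem_source.1 hz) (hfh z hzS) _).1 (hg z hzS)

theorem IsPrincipalBundle.isTrivial_of_section [IsTopologicalGroup G]
    (hπ : IsPrincipalBundle G π) {s : X → P} (hs : Continuous s) (hsπ : ∀ x, π (s x) = x) :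
    IsTrivialPrincipalBundle G π := by
  obtain ⟨g, hgc, hg⟩ := hπ.exists_continuousOn_translation (S := univ) (f := fun p => s (π p))
    (h := id) (hs.comp hπ.continuous_proj).continuousOn continuousOn_id (fun p _ => hsπ (π p))
  replace hg : ∀ p, MulOpposite.op (g p) • s (π p) = p := fun p => hg p (mem_univ p)
  have hgc' : Continuous g := continuousOn_univ.1 hgc
  refine ⟨{ toFun := fun p => (π p, g p)
            invFun := fun q => MulOpposite.op q.2 • s q.1
            left_inv := hg
            right_inv := fun q => ?_
            continuous_toFun := hπ.continuous_proj.prodMk hgc'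
            continuous_invFun := hπ.continuous_act.comp
              ((hs.comp continuous_fst).prodMk continuous_snd) }, fun p => rfl, fun p a => ?_⟩
  · have hq : π (MulOpposite.op q.2 • s q.1) = q.1 := by rw [hπ.proj_act, hsπ]
    refine Prod.ext hq (hπ.op_smul_injective (s q.1) ?_)
    have := hg (MulOpposite.op q.2 • s q.1)
    rwa [hq] at this
  · refine Prod.ext (hπ.proj_act p a) (hπ.op_smul_injective (s (π p)) ?_)
    have := hg (MulOpposite.op a • p)
    rw [hπ.proj_act] at this
    change MulOpposite.op (g (MulOpposite.op a • p)) • _ = MulOpposite.op (g p * a) • _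
    rw [this, MulOpposite.op_mul, mul_smul, hg]

end Translation

/-! ### Lifting maps from boxes -/

/-- `χ` has a continuous lift along `π` over the set `A`. -/
def LiftsOn {P X Y : Type*} [TopologicalSpace P] [TopologicalSpace Y] (π : P → X) (χ : Y → X)
    (A : Set Y) : Prop :=
  ∃ t : Y → P, ContinuousOn t A ∧ ∀ y ∈ A, π (t y) = χ y

theorem Bundle.Trivialization.liftsOn {F P X Y : Type*} [TopologicalSpace F] [TopologicalSpace P]
    [TopologicalSpace X] [TopologicalSpace Y] [Nonempty F] {π : P → X}
    (e : Bundle.Trivialization F π) {χ : Y → X} {A : Set Y} (hχ : ContinuousOn χ A)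
    (h : MapsTo χ A e.baseSet) : LiftsOn π χ A :=
  ⟨fun y => e.toOpenPartialHomeomorph.symm (χ y, Classical.arbitrary F),
    e.continuousOn_invFun.comp (hχ.prodMk continuousOn_const) fun _ hy => e.mem_target.2 (h hy),
    fun _ hy => e.proj_symm_apply' (h hy)⟩

section Lifting

variable {G : Type*} [Group G] [TopologicalSpace G] {P X : Type*} [TopologicalSpace P]
  [TopologicalSpace X] [MulAction (MulOpposite G) P] {π : P → X}

/-- Lifts over `A` and over `B` can be glued if `B` retracts onto `A ∩ B`: the retraction `r`
extends to `B` the function on `A ∩ B` by which the two lifts differ. -/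
theorem LiftsOn.union_of_retraction [IsTopologicalGroup G] (hπ : IsPrincipalBundle G π)
    {Y : Type*} [TopologicalSpace Y] {χ : Y → X} {A B : Set Y} (hA : LiftsOn π χ A)
    (hB : LiftsOn π χ B) (hAc : IsClosed A) (hBc : IsClosed B) {r : Y → Y}
    (hr : ContinuousOn r B) (hrB : MapsTo r B (A ∩ B)) (hrid : ∀ y ∈ A ∩ B, r y = y) :
    LiftsOn π χ (A ∪ B) := by
  classical
  obtain ⟨tA, hA1, hA2⟩ := hA
  obtain ⟨tB, hB1, hB2⟩ := hB
  obtain ⟨g, hg1, hg2⟩ := hπ.exists_continuousOn_translation (S := A ∩ B) (f := tB) (h := tA)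
    (hB1.mono inter_subset_right) (hA1.mono inter_subset_left)
    (fun y hy => (hB2 y hy.2).trans (hA2 y hy.1).symm)
  let t : Y → P := fun y => if y ∈ A then tA y else MulOpposite.op (g (r y)) • tB y
  have htA : ∀ y ∈ A, t y = tA y := fun y hy => if_pos hy
  have htB : ∀ y ∈ B, t y = MulOpposite.op (g (r y)) • tB y := fun y hy => by
    by_cases hyA : y ∈ A
    · rw [htA y hyA, hrid y ⟨hyA, hy⟩, hg2 y ⟨hyA, hy⟩]
    · exact if_neg hyA
  refine ⟨t, ContinuousOn.union_of_isClosed (hA1.congr htA) (ContinuousOn.congr ?_ htB) hAc hBc, ?_⟩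
  · exact hπ.continuous_act.comp_continuousOn (hB1.prodMk (hg1.comp hr hrB))
  · rintro y (hy | hy)
    · rw [htA y hy, hA2 y hy]
    · rw [htB y hy, hπ.proj_act, hB2 y hy]

/-- Gluing along the hyperplane where the `i`-th coordinate equals `c`. -/
theorem LiftsOn.Icc_of_split [IsTopologicalGroup G] (hπ : IsPrincipalBundle G π) {ι : Type*}
    [DecidableEq ι] {χ : (ι → ℝ) → X} {a b : ι → ℝ} {i : ι} {c : ℝ} (hac : a i ≤ c)
    (hcb : c ≤ b i) (h₁ : LiftsOn π χ (Icc a (Function.update b i c)))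
    (h₂ : LiftsOn π χ (Icc (Function.update a i c) b)) : LiftsOn π χ (Icc a b) := by
  have hleft : ∀ y, y ∈ Icc a (Function.update b i c) ↔ y ∈ Icc a b ∧ y i ≤ c := fun y => by
    simp only [mem_Icc, le_update_iff, Pi.le_def (x := y) (y := b)]
    refine ⟨fun ⟨h1, h2, h3⟩ => ⟨⟨h1, fun j => ?_⟩, h2⟩,
      fun ⟨⟨h1, h2⟩, h3⟩ => ⟨h1, h3, fun j _ => h2 j⟩⟩
    by_cases hj : j = i
    · subst hj; exact h2.trans hcb
    · exact h3 j hj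
  have hright : ∀ y, y ∈ Icc (Function.update a i c) b ↔ y ∈ Icc a b ∧ c ≤ y i := fun y => by
    simp only [mem_Icc, update_le_iff, Pi.le_def (x := a) (y := y)]
    refine ⟨fun ⟨⟨h2, h3⟩, h1⟩ => ⟨⟨fun j => ?_, h1⟩, h2⟩,
      fun ⟨⟨h1, h2⟩, h3⟩ => ⟨⟨h3, fun j _ => h1 j⟩, h2⟩⟩
    by_cases hj : j = i
    · subst hj; exact hac.trans h2
    · exact h3 j hj
  have hu : Icc a (Function.update b i c) ∪ Icc (Function.update a i c) b = Icc a b := by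
    ext y
    rw [mem_union, hleft, hright, ← and_or_left]
    exact and_iff_left (le_total _ _)
  rw [← hu]
  refine LiftsOn.union_of_retraction hπ h₁ h₂ isClosed_Icc isClosed_Icc
    (r := fun y => Function.update y i c)
    (continuous_id.update i continuous_const).continuousOn (fun y hy => ?_) (fun y hy => ?_)
  · have hy' := (hright y).1 hy
    have hbox : Function.update y i c ∈ Icc a b :=
      ⟨le_update_iff.2 ⟨hac, fun j _ => hy'.1.1 j⟩, update_le_iff.2 ⟨hcb, fun j _ => hy'.1.2 j⟩⟩
    exact ⟨(hleft _).2 ⟨hbox, by simp⟩, (hright _).2 ⟨hbox, by simp⟩⟩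
  · have : y i = c := le_antisymm ((hleft y).1 hy.1).2 ((hright y).1 hy.2).2
    simp [← this]

/-- Every map from a box into the base of a principal bundle lifts to the total space. -/
theorem IsPrincipalBundle.liftsOn_Icc [IsTopologicalGroup G] (hπ : IsPrincipalBundle G π)
    {ι : Type*} [Fintype ι] {χ : (ι → ℝ) → X} {a b : ι → ℝ} (hχ : ContinuousOn χ (Icc a b)) :
    LiftsOn π χ (Icc a b) := by
  classical
  choose e hxe _ using hπ.locally_trivial
  choose u hu hχu using fun x : X => continuousOn_iff'.1 hχ (e x).baseSet (e x).open_baseSet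
  obtain ⟨δ, hδ, hsub⟩ := lebesgue_number_lemma_of_metric (isCompact_Icc (a := a) (b := b)) hu
    (fun y hy => mem_iUnion.2 ⟨χ y, ((hχu (χ y)).le ⟨hxe (χ y), hy⟩).1⟩)
  have hε : 0 < δ / 2 := by positivity
  -- Boxes are allowed to be long in the directions belonging to `s` only.
  have key : ∀ s : Finset ι, ∀ a' b' : ι → ℝ, Icc a' b' ⊆ Icc a b →
      (∀ i ∉ s, b' i - a' i ≤ δ / 2) → LiftsOn π χ (Icc a' b') := by
    intro s
    induction s using Finset.induction_on with
    | empty =>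
      intro a' b' hab hlen
      rcases (Icc a' b').eq_empty_or_nonempty with h | ⟨y, hy⟩
      · have ⟨p⟩ : Nonempty P := ⟨(e (χ 0)).toOpenPartialHomeomorph.symm (χ 0, 1)⟩
        exact ⟨fun _ => p, by simp [h], by simp [h]⟩
      · obtain ⟨x, hx⟩ := hsub y (hab hy)
        refine (e x).liftsOn (hχ.mono hab)
          (fun z hz => ((hχu x).ge ⟨hx ?_, hab hz⟩).1)
        refine (dist_pi_lt_iff hδ).2 fun i => ?_
        have h1 := hlen i (by simp)
        have h2 := Real.dist_le_of_mem_Icc ⟨hz.1 i, hz.2 i⟩ ⟨hy.1 i, hy.2 i⟩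
        linarith
    | insert i s _ ih =>
      have step : ∀ m : ℕ, ∀ a' b' : ι → ℝ, Icc a' b' ⊆ Icc a b →
          (∀ j ∉ insert i s, b' j - a' j ≤ δ / 2) → b' i - a' i ≤ m * (δ / 2) →
          LiftsOn π χ (Icc a' b') := by
        intro m
        induction m with
        | zero =>
          intro a' b' hab hlen hm
          refine ih a' b' hab fun j hj => ?_
          by_cases hji : j = i
          · subst hji; simp only [Nat.cast_zero, zero_mul] at hm; linarith
          · exact hlen j (by simp [hji, hj])
        | succ m ihm =>
          intro a' b' hab hlen hm
          by_cases hshort : b' i - a' i ≤ δ / 2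
          · refine ih a' b' hab fun j hj => ?_
            by_cases hji : j = i
            · subst hji; exact hshort
            · exact hlen j (by simp [hji, hj])
          · have hac : a' i ≤ a' i + δ / 2 := by linarith
            have hcb : a' i + δ / 2 ≤ b' i := by linarith
            refine LiftsOn.Icc_of_split hπ hac hcb (ih _ _ ?_ fun j hj => ?_)
              (ihm _ _ ?_ (fun j hj => ?_) ?_)
            · exact (Icc_subset_Icc_right (update_le_self_iff.2 hcb)).trans hab
            · by_cases hji : j = i
              · subst hji; simp
              · simpa [hji] using hlen j (by simp [hji, hj])
            · exact (Icc_subset_Icc_left (le_update_self_iff.2 hac)).trans hab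
            · have hji : j ≠ i := fun h => hj (by simp [h])
              simpa [hji] using hlen j hj
            · push_cast at hm
              simp only [Function.update_self]
              linarith
      intro a' b' hab hlen
      obtain ⟨m, hm⟩ := exists_nat_ge ((b' i - a' i) / (δ / 2))
      exact step m a' b' hab hlen ((div_le_iff₀ hε).1 hm)
  exact key Finset.univ a b subset_rfl (fun i hi => absurd (Finset.mem_univ i) hi)

end Lifting

/-! ### Extending maps from the boundary of a cube -/

/-- Every continuous map to `G` from the boundary of the cube `[-1, 1]ⁿ` extends continuously to
`ℝⁿ`; equivalently to the cube, which is a retract of `ℝⁿ`. The cube is the unit ball of the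
maximum norm, as in Mathlib's definition of a cell. -/
def ExtendsFromSphere (G : Type*) [TopologicalSpace G] (n : ℕ) : Prop :=
  ∀ g : (Fin n → ℝ) → G, ContinuousOn g (sphere 0 1) →
    ∃ g' : (Fin n → ℝ) → G, Continuous g' ∧ EqOn g' g (sphere 0 1)

/-- A map into the unit sphere of `V` defined on a closed subset of a space of dimension less than
that of `V` extends to a map that vanishes nowhere. -/
theorem exists_continuous_extension_ne_zero {E V : Type*} [NormedAddCommGroup E] [NormedSpace ℝ E]
    [FiniteDimensional ℝ E] [NormedAddCommGroup V] [NormedSpace ℝ V] [FiniteDimensional ℝ V]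
    (hdim : Module.finrank ℝ E < Module.finrank ℝ V) {B : Set E} (hB : IsClosed B) {f : E → V}
    (hf : ContinuousOn f B) (hf1 : ∀ x ∈ B, ‖f x‖ = 1) :
    ∃ F : E → V, Continuous F ∧ EqOn F f B ∧ ∀ x, F x ≠ 0 := by
  have := TietzeExtension.of_tvs.{_, _} ℝ (E := V)
  obtain ⟨F₀, hF₀⟩ := ContinuousMap.exists_restrict_eq hB ⟨B.domRestrict f, hf.domRestrict⟩
  have hF₀B : ∀ x ∈ B, F₀ x = f x := fun x hx => congrArg (fun k : C(B, V) => k ⟨x, hx⟩) hF₀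
  obtain ⟨g, hg, hgF, -⟩ := F₀.continuous.exists_contDiff_approx 1 (ε := fun _ => 1 / 4)
    continuous_const (fun _ => by norm_num)
  obtain ⟨v, hv, hvg⟩ := (hg.dense_compl_range_of_finrank_lt_finrank hdim).exists_dist_lt 0
    (show (0 : ℝ) < 1 / 4 by norm_num)
  rw [dist_zero_left] at hvg
  have hclose : ∀ x, ‖g x - v - F₀ x‖ < 1 / 2 := fun x => by
    have h1 := hgF x
    rw [dist_eq_norm] at h1
    calc ‖g x - v - F₀ x‖ = ‖(g x - F₀ x) - v‖ := by congr 1; abel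
      _ ≤ ‖g x - F₀ x‖ + ‖v‖ := norm_sub_le _ _
      _ < 1 / 2 := by linarith
  have hne : ∀ x, g x - v ≠ 0 := fun x h => hv ⟨x, sub_eq_zero.1 h⟩
  -- The weight is `1` where `‖F₀‖ ≥ 1`, hence on `B`, and `0` where `‖F₀‖ ≤ 1 / 2`; in between,
  -- the interpolation stays within `1 / 2` of `F₀`.
  let w : E → ℝ := fun x => max 0 (min 1 (2 * ‖F₀ x‖ - 1))
  have hw : Continuous w := by fun_prop
  refine ⟨fun x => (g x - v) + w x • (F₀ x - (g x - v)), ?_, fun x hx => ?_, fun x h => ?_⟩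
  · have := hg.continuous
    fun_prop
  · have : w x = 1 := by simp only [w, hF₀B x hx, hf1 x hx]; norm_num
    simp [this, hF₀B x hx]
  · rcases le_or_gt ‖F₀ x‖ (1 / 2) with hsmall | hlarge
    · have : w x = 0 := max_eq_left ((min_le_right _ _).trans (by linarith))
      exact hne x (by simpa [this] using h)
    · have hw0 : 0 ≤ w x := le_max_left _ _
      have hw1 : w x ≤ 1 := max_le zero_le_one (min_le_left _ _)
      have hF : F₀ x = -((1 - w x) • (g x - v - F₀ x)) := by
        rw [← sub_eq_zero, sub_neg_eq_add, ← h]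
        module
      have h1 : ‖F₀ x‖ = (1 - w x) * ‖g x - v - F₀ x‖ := by
        conv_lhs => rw [hF]
        rw [norm_neg, norm_smul, Real.norm_of_nonneg (by linarith)]
      nlinarith [hclose x, norm_nonneg (g x - v - F₀ x)]

/-- The first row of a matrix, as a vector with the Euclidean norm. -/
noncomputable def firstRow (A : Matrix (Fin 2) (Fin 2) ℂ) : EuclideanSpace ℂ (Fin 2) :=
  WithLp.toLp 2 (A 0)

/-- The matrix with first row `v` and second row orthogonal to it. It lies in `SU(2)` when
`‖v‖ = 1`. -/
noncomputable def quaternionMatrix (v : EuclideanSpace ℂ (Fin 2)) : Matrix (Fin 2) (Fin 2) ℂ :=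
  !![v 0, v 1; -star (v 1), star (v 0)]

theorem quaternionMatrix_mem {v : EuclideanSpace ℂ (Fin 2)} (hv : ‖v‖ = 1) :
    quaternionMatrix v ∈ Matrix.specialUnitaryGroup (Fin 2) ℂ := by
  have h : v 0 * star (v 0) + v 1 * star (v 1) = 1 := by
    have h2 := EuclideanSpace.norm_sq_eq v
    rw [hv, Fin.sum_univ_two] at h2
    rw [← starRingEnd_apply, ← starRingEnd_apply, Complex.mul_conj', Complex.mul_conj']
    have h3 := congrArg Complex.ofReal h2.symm
    push_cast at h3
    simpa using h3
  rw [Matrix.mem_specialUnitaryGroup_iff, Matrix.mem_unitaryGroup_iff]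
  constructor
  · ext i j
    simp only [RCLike.star_def] at h
    fin_cases i <;> fin_cases j <;>
      simp [quaternionMatrix, Matrix.mul_apply, Fin.sum_univ_two]
    · exact h
    · ring
    · ring
    · linear_combination h
  · rw [quaternionMatrix, Matrix.det_fin_two_of]
    linear_combination h

theorem quaternionMatrix_firstRow (A : SU2) : quaternionMatrix (firstRow A.1) = A.1 := by
  obtain ⟨hu, hd⟩ := Matrix.mem_specialUnitaryGroup_iff.1 A.2
  -- The inverse of a matrix of determinant `1` is its adjugate; here it is also the adjoint.
  have h : star A.1 = A.1.adjugate := by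
    have h1 : A.1.adjugate * A.1 = 1 := by rw [Matrix.adjugate_mul, hd, one_smul]
    rw [← one_mul (star A.1), ← h1, mul_assoc, Matrix.mem_unitaryGroup_iff.1 hu, mul_one]
  rw [Matrix.adjugate_fin_two] at h
  have h0 : star (A.1 0 0) = A.1 1 1 := congrFun (congrFun h 0) 0
  have h1 : star (A.1 0 1) = -A.1 1 0 := congrFun (congrFun h 1) 0
  ext i j
  fin_cases i <;> fin_cases j <;>
    simp only [quaternionMatrix, firstRow, h0, h1, neg_neg] <;> rfl

theorem norm_firstRow (A : SU2) : ‖firstRow A.1‖ = 1 := by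
  have h := congrFun (congrFun
    (Matrix.mem_unitaryGroup_iff.1 (Matrix.mem_specialUnitaryGroup_iff.1 A.2).1) 0) 0
  rw [Matrix.mul_apply, Fin.sum_univ_two, Matrix.star_apply, Matrix.star_apply,
    ← starRingEnd_apply, ← starRingEnd_apply, Complex.mul_conj', Complex.mul_conj',
    Matrix.one_apply_eq] at h
  have h2 : ‖firstRow A.1‖ ^ 2 = 1 := by
    rw [EuclideanSpace.norm_sq_eq, Fin.sum_univ_two]
    exact_mod_cast h
  exact (pow_eq_one_iff_of_nonneg (norm_nonneg _) two_ne_zero).1 h2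

theorem extendsFromSphere_specialUnitaryGroup {n : ℕ} (hn : n ≤ 3) : ExtendsFromSphere SU2 n := by
  intro g hg
  have hdim : Module.finrank ℝ (Fin n → ℝ) < Module.finrank ℝ (EuclideanSpace ℂ (Fin 2)) := by
    rw [Module.finrank_fin_fun, finrank_real_of_complex, finrank_euclideanSpace_fin]
    omega
  have hrow : Continuous fun A : SU2 => firstRow A.1 :=
    (PiLp.continuous_toLp 2 _).comp ((continuous_apply 0).comp continuous_subtype_val)
  obtain ⟨F, hF, hFg, hF0⟩ := exists_continuous_extension_ne_zero hdim isClosed_sphere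
    (hrow.comp_continuousOn hg) (fun x _ => norm_firstRow (g x))
  have hmat : Continuous quaternionMatrix := by
    unfold quaternionMatrix
    fun_prop
  have hunit : ∀ x, ‖(‖F x‖⁻¹ : ℝ) • F x‖ = 1 := fun x => by
    rw [norm_smul, norm_inv, norm_norm, inv_mul_cancel₀ (norm_ne_zero_iff.2 (hF0 x))]
  refine ⟨fun x => ⟨_, quaternionMatrix_mem (hunit x)⟩, ?_, fun x hx => Subtype.ext ?_⟩
  · exact (hmat.comp ((hF.norm.inv₀ fun x => norm_ne_zero_iff.2 (hF0 x)).smul hF)).subtype_mk _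
  · have h1 : F x = firstRow (g x).1 := hFg hx
    simp only [h1, norm_firstRow, inv_one, one_smul, quaternionMatrix_firstRow]

/-! ### Sections over complexes -/

/-- A lift of the characteristic map of a cell that is given on the boundary extends over the
cell: correct an arbitrary lift by an extension of the function comparing the two on the boundary. -/
theorem IsPrincipalBundle.exists_lift_extending {G : Type*} [Group G] [TopologicalSpace G]
    [IsTopologicalGroup G] {P X : Type*} [TopologicalSpace P] [TopologicalSpace X]
    [MulAction (MulOpposite G) P] {π : P → X} (hπ : IsPrincipalBundle G π) {n : ℕ}
    (hn : ExtendsFromSphere G n) {χ : (Fin n → ℝ) → X} (hχ : ContinuousOn χ (closedBall 0 1))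
    {τ : (Fin n → ℝ) → P} (hτ : ContinuousOn τ (sphere 0 1))
    (hτχ : ∀ y ∈ sphere (0 : Fin n → ℝ) 1, π (τ y) = χ y) :
    ∃ t : (Fin n → ℝ) → P, ContinuousOn t (closedBall 0 1) ∧
      (∀ y ∈ closedBall (0 : Fin n → ℝ) 1, π (t y) = χ y) ∧ EqOn t τ (sphere 0 1) := by
  have hbox : closedBall (0 : Fin n → ℝ) 1 = Icc (-1) 1 := by
    ext y
    simp only [mem_closedBall_zero_iff, mem_Icc, pi_norm_le_iff_of_nonneg zero_le_one,
      Real.norm_eq_abs, abs_le, Pi.le_def, Pi.neg_apply, Pi.one_apply, forall_and]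
  obtain ⟨t, ht, htχ⟩ := hπ.liftsOn_Icc (hbox ▸ hχ)
  rw [← hbox] at ht htχ
  obtain ⟨g, hg, hgt⟩ := hπ.exists_continuousOn_translation (ht.mono sphere_subset_closedBall) hτ
    (fun y hy => (htχ y (sphere_subset_closedBall hy)).trans (hτχ y hy).symm)
  obtain ⟨g', hg', hgg'⟩ := hn g hg
  refine ⟨fun y => MulOpposite.op (g' y) • t y,
    hπ.continuous_act.comp_continuousOn (ht.prodMk hg'.continuousOn),
    fun y hy => by rw [hπ.proj_act, htχ y hy], fun y hy => ?_⟩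
  simp only [hgg' hy, hgt y hy]

/-- Continuity on the image of a compact set in a Hausdorff space can be checked on the compact set,
which maps onto its image by a quotient map. -/
theorem IsCompact.continuousOn_image_of_comp {Y X Z : Type*} [TopologicalSpace Y]
    [TopologicalSpace X] [T2Space X] [TopologicalSpace Z] {K : Set Y} (hK : IsCompact K)
    {χ : Y → X} (hχ : ContinuousOn χ K) {f : X → Z} (hf : ContinuousOn (f ∘ χ) K) :
    ContinuousOn f (χ '' K) := by
  refine continuousOn_iff_isClosed.2 fun t ht => ?_
  obtain ⟨u, hu, hut⟩ := continuousOn_iff_isClosed.1 hf t ht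
  have hc : IsCompact (f ∘ χ ⁻¹' t ∩ K) := hut ▸ hK.inter_left hu
  refine ⟨χ '' (f ∘ χ ⁻¹' t ∩ K), (hc.image_of_continuousOn (hχ.mono inter_subset_right)).isClosed,
    ?_⟩
  ext x
  constructor
  · rintro ⟨hx, y, hy, rfl⟩
    exact ⟨⟨y, ⟨hx, hy⟩, rfl⟩, y, hy, rfl⟩
  · rintro ⟨⟨y, ⟨hx, hy⟩, rfl⟩, h⟩
    exact ⟨hx, h⟩

open Topology.CWComplex in
/-- A section over the cells of dimension less than `N`. Continuity is only recorded on each closed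
cell: the frontier of a cell of dimension `N` lies in finitely many of these, so the section is
continuous there, which is what the induction needs. -/
theorem IsPrincipalBundle.exists_section_closedCell {G : Type*} [Group G] [TopologicalSpace G]
    [IsTopologicalGroup G] {P X : Type*} [TopologicalSpace P] [TopologicalSpace X] [T2Space X]
    [MulAction (MulOpposite G) P] {π : P → X} (hπ : IsPrincipalBundle G π)
    [CWComplex (univ : Set X)] (N : ℕ) (hN : ∀ n < N, ExtendsFromSphere G n) :
    ∃ σ : X → P, ∀ n < N, ∀ e : cell (univ : Set X) n,
      ContinuousOn σ (closedCell n e) ∧ ∀ x ∈ closedCell n e, π (σ x) = x := by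
  classical
  induction N with
  | zero =>
    choose e hxe _ using hπ.locally_trivial
    exact ⟨fun x => (e x).toOpenPartialHomeomorph.symm (x, 1), fun n hn => absurd hn n.not_lt_zero⟩
  | succ N ih =>
    obtain ⟨σ, hσ⟩ := ih fun n hn => hN n (hn.trans N.lt_succ_self)
    have hfront : ∀ e : cell (univ : Set X) N, ContinuousOn σ (cellFrontier N e) ∧
        ∀ x ∈ cellFrontier N e, ∃ m < N, ∃ j : cell (univ : Set X) m, x ∈ closedCell m j := by
      intro e
      obtain ⟨I, hI⟩ := CWComplex.cellFrontier_subset_finite_closedCell N e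
      constructor
      · let S : (Σ m : Fin N, I m) → Set X := fun q => closedCell q.1.1 q.2.1
        have hS : ContinuousOn σ (⋃ q, S q) :=
          (locallyFinite_of_finite S).continuousOn_iUnion
            (fun q => CWComplex.isClosed_closedCell) (fun q => (hσ q.1 q.1.2 q.2.1).1)
        refine hS.mono fun x hx => ?_
        have := hI hx
        simp only [mem_iUnion] at this
        obtain ⟨m, hm, j, hj, hxj⟩ := this
        exact mem_iUnion.2 ⟨⟨⟨m, hm⟩, ⟨j, hj⟩⟩, hxj⟩
      · intro x hx
        have := hI hx
        simp only [mem_iUnion] at this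
        obtain ⟨m, hm, j, hj, hxj⟩ := this
        exact ⟨m, hm, j, hxj⟩
    choose t ht htπ htσ using fun e : cell (univ : Set X) N =>
      hπ.exists_lift_extending (hN N N.lt_succ_self) (RelCWComplex.continuousOn N e)
        (τ := σ ∘ map N e)
        ((hfront e).1.comp ((RelCWComplex.continuousOn N e).mono sphere_subset_closedBall)
          (fun y hy => mem_image_of_mem _ hy))
        (fun y hy => by
          obtain ⟨m, hm, j, hj⟩ := (hfront e).2 _ (mem_image_of_mem (map N e) hy)
          exact (hσ m hm j).2 _ hj)
    let σ' : X → P := fun x =>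
      if h : ∃ e : cell (univ : Set X) N, x ∈ openCell N e then t h.choose ((map N h.choose).symm x)
      else σ x
    have hold : ∀ m < N, ∀ j : cell (univ : Set X) m, ∀ x ∈ closedCell m j, σ' x = σ x := by
      intro m hm j x hx
      refine dif_neg ?_
      rintro ⟨e, he⟩
      have hd := CWComplex.disjoint_skeletonLT_openCell (C := (univ : Set X)) (n := N) (j := e)
        le_rfl
      have hsk := CWComplex.skeletonLT_mono (C := (univ : Set X))
        (show ((m : ℕ∞) + 1) ≤ N by exact_mod_cast hm)
      exact hd.le_bot ⟨hsk (CWComplex.closedCell_subset_skeletonLT m j hx), he⟩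
    have hnew : ∀ e : cell (univ : Set X) N, EqOn (σ' ∘ map N e) (t e) (closedBall 0 1) := by
      intro e y hy
      rw [← sphere_union_ball] at hy
      rcases hy with hy | hy
      · obtain ⟨m, hm, j, hj⟩ := (hfront e).2 _ (mem_image_of_mem (map N e) hy)
        rw [htσ e hy]
        exact hold m hm j _ hj
      · have hex : ∃ e' : cell (univ : Set X) N, map N e y ∈ openCell N e' :=
          ⟨e, mem_image_of_mem _ hy⟩
        have heq : hex.choose = e := by
          by_contra hne
          exact (CWComplex.disjoint_openCell_of_ne (by simpa using hne)).le_bot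
            ⟨hex.choose_spec, mem_image_of_mem (map N e) hy⟩
        have h1 : σ' (map N e y) = t hex.choose ((map N hex.choose).symm (map N e y)) := dif_pos hex
        rw [Function.comp_apply, h1, heq,
          (map N e).left_inv (by rwa [RelCWComplex.source_eq])]
    refine ⟨σ', fun n hn e => ?_⟩
    rcases Nat.lt_succ_iff_lt_or_eq.1 hn with hlt | rfl
    · exact ⟨(hσ n hlt e).1.congr (hold n hlt e),
        fun x hx => by rw [hold n hlt e x hx, (hσ n hlt e).2 x hx]⟩
    · refine ⟨(isCompact_closedBall 0 1).continuousOn_image_of_comp (RelCWComplex.continuousOn n e)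
        ((ht e).congr (hnew e)), ?_⟩
      rintro _ ⟨y, hy, rfl⟩
      have h1 : σ' (map n e y) = t e y := hnew e hy
      rw [h1, htπ e y hy]

instance : IsTopologicalGroup SU2 where
  continuous_inv := by
    refine Continuous.subtype_mk (f := fun A : SU2 => star A.1) ?_ _
    fun_prop

theorem proposition3p8 {X : Type*} [TopologicalSpace X] [T2Space X]
    [Topology.CWComplex (Set.univ : Set X)]
    (hdim : ∀ n : ℕ, 3 < n → IsEmpty (Topology.RelCWComplex.cell (Set.univ : Set X) n))
    {P : Type*} [TopologicalSpace P] [MulAction (MulOpposite SU2) P]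
    (π : P → X) (hπ : IsPrincipalBundle SU2 π) :
    IsTrivialPrincipalBundle SU2 π := by
  obtain ⟨σ, hσ⟩ := hπ.exists_section_closedCell 4
    fun n hn => extendsFromSphere_specialUnitaryGroup (Nat.lt_succ_iff.1 hn)
  have hcell : ∀ n (e : RelCWComplex.cell (univ : Set X) n),
      ContinuousOn σ (RelCWComplex.closedCell n e) ∧
        ∀ x ∈ RelCWComplex.closedCell n e, π (σ x) = x := fun n e =>
    if hn : n < 4 then hσ n hn e else ((hdim n (not_lt.1 hn)).false e).elim
  refine hπ.isTrivial_of_section (s := σ) (continuous_iff_isClosed.2 fun t ht => ?_) fun x => ?_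
  · refine (CWComplex.closed univ _ (subset_univ _)).2 fun n e => ?_
    rw [inter_comm]
    exact (hcell n e).1.preimage_isClosed_of_isClosed CWComplex.isClosed_closedCell ht
  · have hx : x ∈ ⋃ (n : ℕ) (j : RelCWComplex.cell (univ : Set X) n), RelCWComplex.closedCell n j :=
      (CWComplex.union (C := (univ : Set X))).ge (mem_univ x)
    simp only [mem_iUnion] at hx
    obtain ⟨n, e, hxe⟩ := hx
    exact (hcell n e).2 x hxe
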